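/- **Setting.** Fix $d\in\mathbb N$, finite sets $\mathcal X,\mathcal Z\subset\mathbb R^d$ with $\mathcal X\neq\emptyset$ and a threshold $\gamma\in\mathbb R$. An instance is a pair $(\theta,\mu)\in\mathbb R^d\times\mathbb R^d$; an arm $z\in\mathcal Z$ is *safe* if $z^\top\mu\le\gamma$. A learner, using the past and its own internal randomness, in each round either stops or plays some $x_t\in\mathcal X$ and observes $r_t=\theta^\top x_t+w_t$ and $s_t=\mu^\top x_t+w_t'$, where all the $w_t,w_t'$ are independent $\mathcal N(0,1)$ variables, independent of the internal randomness. When it stops, after $\tau\in\{0,1,2,\dots\}\cup\{\infty\}$ rounds, it returns an arm $\widehat z\in\mathcal Z$ or returns no arm. An arm is *correct* for $(\theta,\mu)$ if it is safe and $z^\top\theta\ge z'^\top\theta$ for every safe $z'\in\mathcal Z$; if no arm is safe, no arm is correct. Call $(\theta,\mu)$ *nondegenerate with best safe arm $z_*$* if $z_*\in\mathcal Z$, $z_*^\top\mu<\gamma$, and $z^\top\theta<z_*^\top\theta$ for every safe $z\in\mathcal Z\setminus\{z_*\}$. The learner is *$(0,\delta)$-PAC* if on every instance $(\theta,\mu)\in\mathbb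 R^d\times\mathbb R^d$ the probability that it stops and returns an incorrect arm is at most $\delta$, and on every nondegenerate instance it stops and returns a correct arm with probability at least $1-\delta$. For $\lambda$ in the simplex $\triangle_{\mathcal X}$ let $A(\lambda)=\sum_{x\in\mathcal X}\lambda_x xx^\top$ and $\|y\|_{A(\lambda)^{-1}}^2=y^\top A(\lambda)^{-1}y$; if $A(\lambda)$ is singular this means $y^\top v$ for any $v$ with $A(\lambda)v=y$, and $+\infty$ if there is no such $v$. Let $\mathfrak p(x)=\max\{x,0\}$, and read a ratio with denominator $0$ as $+\infty$. **Theorem (Oracle Lower Bound).** Let $0<\delta<1/2.4$, let $\tau$ be the stopping time of a $(0,\delta)$-PAC learner, and let $(\theta_*,\mu_*)$ be a nondegenerate instance with best safe arm $z_*$. Put $\Delta(z)=\theta_*^\top(z_*-z)$ and $\Delta_{\mathrm{safe}}(z)=\gamma-\mu_*^\top z$. Then $$\frac{\mathbb E_{\theta_*,\mu_*}[\tau]}{\log\frac1{2.4\,\delta}}\ \ge\ \min_{\lambda\in\triangle_{\mathcal X}}\max\left\{\max_{z\in\mathcal Z\setminus\{z_*\}}\min\left\{\frac{\|z\|^2_{A(\lambda)^{-1}}}{\mathfrak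 p(-\Delta_{\mathrm{safe}}(z))^2},\ \frac{\|z-z_*\|^2_{A(\lambda)^{-1}}}{\mathfrak p(\Delta(z))^2}\right\},\ \frac{\|z_*\|^2_{A(\lambda)^{-1}}}{(z_*^\top\mu_*-\gamma)^2}\right\},$$ where the maximum over an empty set of arms is $0$. -/

import Mathlib

open MeasureTheory ProbabilityTheory
open scoped ENNReal

namespace SafeBandit

universe u

/-- The ambient space `ℝ^d`, with its Euclidean inner product. -/
abbrev Vec (d : ℕ) : Type := EuclideanSpace ℝ (Fin d)

/-- The record of `n` rounds: the action played, the observed reward and the observed safety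
value of every round. -/
abbrev Hist (d n : ℕ) : Type := Fin n → Vec d × ℝ × ℝ

/-! ### Instances -/

section Instances

variable {d : ℕ}

/-- The arm `z` is safe under the constraint vector `μ`. -/
def IsSafe (γ : ℝ) (μ z : Vec d) : Prop := inner ℝ z μ ≤ γ

/-- The set `Z₀` of correct answers for the instance `(θ, μ)`: the safe arms of `Z` whose value is
at least that of every safe arm of `Z`. It is empty if no arm of `Z` is safe. -/
def correctArms (Z : Finset (Vec d)) (γ : ℝ) (θ μ : Vec d) : Set (Vec d) :=
  {z | z ∈ Z ∧ IsSafe γ μ z ∧ ∀ z' ∈ Z, IsSafe γ μ z' → (inner ℝ z' θ : ℝ) ≤ inner ℝ z θ}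

/-- `z` is the unique best safe arm of the instance `(θ, μ)`, and it does not lie on the boundary
of the safety constraint. -/
def IsBestArm (Z : Finset (Vec d)) (γ : ℝ) (θ μ z : Vec d) : Prop :=
  z ∈ Z ∧ (inner ℝ z μ : ℝ) < γ ∧
    ∀ z' ∈ Z, z' ≠ z → IsSafe γ μ z' → (inner ℝ z' θ : ℝ) < inner ℝ z θ

/-- The optimality gap `Δ(z) = θᵀ(z⋆ - z)`. -/
noncomputable def gap (θ zstar z : Vec d) : ℝ := inner ℝ θ (zstar - z)

/-- The safety gap `Δ_safe(z) = γ - μᵀz`. -/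
noncomputable def safetyGap (γ : ℝ) (μ z : Vec d) : ℝ := γ - inner ℝ μ z

end Instances

/-! ### Learners and their interaction with an instance -/

/-- A (randomised) learner with action set `X` and arm set `Z`. The internal randomness is a seed,
drawn once from `seedLaw`. After `n` rounds the learner knows its seed and the history; on the event
`halt n` it stops and returns either an arm of `Z`, or `none` (no arm is returned); otherwise it
plays `action n`. -/
structure Learner {d : ℕ} (X Z : Finset (Vec d)) where
  Seed : Type u
  [seedSpace : MeasurableSpace Seed]
  seedLaw : Measure Seed
  [seedProb : IsProbabilityMeasure seedLaw]
  action : (n : ℕ) → Seed × Hist d n → X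
  halt : (n : ℕ) → Set (Seed × Hist d n)
  recommend : (n : ℕ) → Seed × Hist d n → Option Z
  measurable_action : ∀ n, Measurable (action n)
  measurableSet_halt : ∀ n, MeasurableSet (halt n)
  measurableSet_recommend : ∀ n (z : Z), MeasurableSet {h | recommend n h = some z}

attribute [instance] Learner.seedSpace Learner.seedProb

namespace Learner

variable {d : ℕ} {X Z : Finset (Vec d)} (L : Learner.{u} X Z)

/-- A sample point: the seed, and the reward noise and safety noise of every round. -/
abbrev Omega : Type u := L.Seed × (ℕ → ℝ × ℝ)

/-- The law of the sample point: the seed is independent of the noise, and all noise variables are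
independent standard Gaussians. -/
noncomputable def law : Measure L.Omega :=
  L.seedLaw.prod (Measure.infinitePi fun _ : ℕ => (gaussianReal 0 1).prod (gaussianReal 0 1))

/-- The history of the first `n` rounds on the instance `(θ, μ)`: the action `x` yields the
observations `θᵀx + noise` and `μᵀx + noise`. -/
noncomputable def history (θ μ : Vec d) (ω : L.Omega) : (n : ℕ) → Hist d n
  | 0 => Fin.elim0
  | n + 1 =>
    let h := history θ μ ω n
    let x : Vec d := L.action n (ω.1, h)
    Fin.snoc (α := fun _ => Vec d × ℝ × ℝ) h
      (x, inner ℝ θ x + (ω.2 n).1, inner ℝ μ x + (ω.2 n).2)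

/-- The stopping time on the instance `(θ, μ)`, i.e. the number of rounds played; it is `⊤` if the
learner never stops. -/
noncomputable def stoppingTime (θ μ : Vec d) (ω : L.Omega) : ℕ∞ :=
  ⨅ (n : ℕ) (_ : (ω.1, L.history θ μ ω n) ∈ L.halt n), (n : ℕ∞)

/-- The event that, on the instance `(θ, μ)`, the learner stops and returns an arm belonging
to `S`. -/
def returnsIn (θ μ : Vec d) (S : Set (Vec d)) : Set L.Omega :=
  {ω | ∃ (n : ℕ) (z : Z), L.stoppingTime θ μ ω = n ∧
    L.recommend n (ω.1, L.history θ μ ω n) = some z ∧ (z : Vec d) ∈ S}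

/-- The expected stopping time on the instance `(θ, μ)`. -/
noncomputable def expectedStoppingTime (θ μ : Vec d) : ℝ≥0∞ :=
  ∫⁻ ω, (L.stoppingTime θ μ ω : ℝ≥0∞) ∂L.law

/-- `(0, δ)`-PAC learner: on every instance the probability of returning an incorrect arm is at most
`δ` (if no arm is safe, every arm is incorrect), and on every instance that has a unique best safe
arm off the constraint boundary a correct arm is returned with probability at least `1 - δ`. -/
def IsPAC (γ δ : ℝ) : Prop :=
  (∀ θ μ : Vec d, L.law (L.returnsIn θ μ (correctArms Z γ θ μ)ᶜ) ≤ ENNReal.ofReal δ) ∧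
  (∀ θ μ : Vec d, (∃ z, IsBestArm Z γ θ μ z) →
    ENNReal.ofReal (1 - δ) ≤ L.law (L.returnsIn θ μ (correctArms Z γ θ μ)))

end Learner

/-! ### The complexity -/

section Complexity

variable {d : ℕ}

/-- The design matrix `A(lam) = ∑ₓ lamₓ x xᵀ`. -/
noncomputable def designMatrix (X : Finset (Vec d)) (lam : X → ℝ) : Matrix (Fin d) (Fin d) ℝ :=
  ∑ x : X, lam x • Matrix.vecMulVec (x : Vec d).ofLp (x : Vec d).ofLp

/-- `‖y‖²_{A⁻¹}` for a positive semidefinite `A`, as an extended nonnegative real: it is `yᵀv` for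
any solution `v` of `A v = y`, and `⊤` if there is none. See `invNormSq_of_isUnit` for
invertible `A`. -/
noncomputable def invNormSq (A : Matrix (Fin d) (Fin d) ℝ) (y : Vec d) : ℝ≥0∞ :=
  ⨅ (v : Fin d → ℝ) (_ : A.mulVec v = y.ofLp), ENNReal.ofReal (y.ofLp ⬝ᵥ v)

theorem invNormSq_of_isUnit (A : Matrix (Fin d) (Fin d) ℝ) (hA : IsUnit A.det) (y : Vec d) :
    invNormSq A y = ENNReal.ofReal (y.ofLp ⬝ᵥ A⁻¹.mulVec y.ofLp) := by
  have h : ∀ v : Fin d → ℝ, A.mulVec v = y.ofLp ↔ v = A⁻¹.mulVec y.ofLp := by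
    intro v
    constructor
    · intro hv
      rw [← hv, Matrix.mulVec_mulVec, Matrix.nonsing_inv_mul A hA, Matrix.one_mulVec]
    · rintro rfl
      rw [Matrix.mulVec_mulVec, Matrix.mul_nonsing_inv A hA, Matrix.one_mulVec]
  simp only [invNormSq, h, iInf_iInf_eq_left]

/-- The ratio `a / b`, equal to `⊤` whenever `b = 0`. -/
noncomputable def ratio (a : ℝ≥0∞) (b : ℝ) : ℝ≥0∞ :=
  open Classical in if b = 0 then ⊤ else a / ENNReal.ofReal b

/-- The positive part `max {x, 0}`. -/
noncomputable def pos (x : ℝ) : ℝ := max x 0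

/-- The quantity to be minimised over allocations `lam`. -/
noncomputable def complexityAt (X Z : Finset (Vec d)) (γ : ℝ) (θ μ zstar : Vec d) (lam : X → ℝ) :
    ℝ≥0∞ :=
  max
    (⨆ z ∈ Z, ⨆ (_ : z ≠ zstar),
      min
        (ratio (invNormSq (designMatrix X lam) z) (pos (-safetyGap γ μ z) ^ 2))
        (ratio (invNormSq (designMatrix X lam) (z - zstar)) (pos (gap θ zstar z) ^ 2)))
    (ratio (invNormSq (designMatrix X lam) zstar) ((inner ℝ zstar μ - γ) ^ 2))

/-- The minimum of `complexityAt` over the simplex of allocations. -/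
noncomputable def complexity (X Z : Finset (Vec d)) (γ : ℝ) (θ μ zstar : Vec d) : ℝ≥0∞ :=
  ⨅ lam ∈ stdSimplex ℝ X, complexityAt X Z γ θ μ zstar lam

end Complexity

end SafeBandit

namespace SafeBandit

universe u

/-! The bound is a change of measure followed by the dual description of `‖y‖²_{A⁻¹}`. If `zstar` is
incorrect on a second instance, the event of returning it has probability at least `1 - δ` on the
true instance and at most `δ` on the other. Such a discrepancy forces the mean log-likelihood ratio
at the stopping time to be at least `log (1 / (2.4 δ))` (`binary_kl_le_integral`,
`log_one_div_le_binary_kl`). For Gaussian noise this mean is the sum over actions of the expected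
number of plays times half the squared differences of the two means (`integral_tsum_playLik`);
`log_le_information` combines the two facts.

Dividing expected plays by `T = 𝔼[τ]` gives an allocation `lam`, and the information becomes `T/2`
times the sum of the quadratic forms of `A(lam)` at the reward and safety perturbations. The
cheapest `η` with `yᵀη = c > 0` has quadratic form `c² / ‖y‖²_{A⁻¹}`, or zero if `y` is outside the
range (`exists_perturbation_of_lt_ratio`). If some term of the complexity at `lam` exceeded `T / log
(1 / (2.4 δ))`, perturbations this cheap would make `zstar` incorrect with too little information.
An arm `z` needs both a safety and a reward perturbation; the information averages their two costs,
so it suffices that each is small, hence the inner minimum. -/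

/-! ### The two-point testing inequality -/

/-- After cancelling `-log δ`, what remains is `2δ (-log δ) + (1 - 2δ) (-log (1 - δ)) ≤ log 2.4`.
Both logarithms are bounded by `log x ≤ x - 1`, with equality at `δ = 1/3`. Splitting `2.4 = 8/5 ·
3/2` makes `log (3/2)` cancel, so only `log 2` has to be estimated. -/
theorem log_one_div_le_binary_kl {δ : ℝ} (hδ : 0 < δ) (hδ' : δ < 1 / 2.4) :
    Real.log (1 / (2.4 * δ)) ≤ (1 - 2 * δ) * Real.log ((1 - δ) / δ) := by
  have hδ2 : δ < 5 / 12 := by norm_num at hδ' ⊢; exact hδ'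
  have h1 : 0 < 1 - δ := by linarith
  have hlog16 : 21 / 31 * Real.log 2 ≤ Real.log (8 / 5) := by
    have h : Real.log ((2 : ℝ) ^ 21) ≤ Real.log ((8 / 5 : ℝ) ^ 31) :=
      Real.log_le_log (by positivity) (by norm_num)
    rw [Real.log_pow, Real.log_pow] at h
    push_cast at h
    linarith
  have e1 : Real.log (1 / (2.4 * δ)) =
      -(Real.log (8 / 5) + Real.log (3 / 2)) - Real.log δ := by
    rw [← Real.log_mul (by norm_num) (by norm_num), one_div, Real.log_inv,
      Real.log_mul (by norm_num) hδ.ne']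
    norm_num
    ring
  have e2 : Real.log ((1 - δ) / δ) = Real.log (1 - δ) - Real.log δ :=
    Real.log_div h1.ne' hδ.ne'
  have t1 : -Real.log δ ≤ Real.log 2 + Real.log (3 / 2) + 1 / (3 * δ) - 1 := by
    have h := Real.log_le_sub_one_of_pos (x := 1 / (3 * δ)) (by positivity)
    rw [one_div, Real.log_inv, Real.log_mul (by norm_num) hδ.ne',
      show (3 : ℝ) = 2 * (3 / 2) by norm_num, Real.log_mul (by norm_num) (by norm_num)] at h
    rw [one_div]
    norm_num at h ⊢
    linarith
  have t2 : -Real.log (1 - δ) ≤ Real.log (3 / 2) + (δ - 1 / 3) / (1 - δ) := by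
    have h := Real.log_le_sub_one_of_pos (x := (3 / 2 * (1 - δ))⁻¹) (by positivity)
    rw [Real.log_inv, Real.log_mul (by norm_num) h1.ne'] at h
    have : (3 / 2 * (1 - δ))⁻¹ - 1 = (δ - 1 / 3) / (1 - δ) := by
      field_simp
      ring
    linarith
  have m1 := mul_le_mul_of_nonneg_left t1 (by linarith : 0 ≤ 2 * δ)
  have m2 := mul_le_mul_of_nonneg_left t2 (by linarith : 0 ≤ 1 - 2 * δ)
  have hl := Real.log_two_gt_d9
  have hl' := Real.log_two_lt_d9
  have m1' : 2 * δ * (1 / (3 * δ)) = 2 / 3 := by field_simp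
  have key : 2 / 3 - 2 * δ + (1 - 2 * δ) * ((δ - 1 / 3) / (1 - δ)) ≤
      (21 / 31 - 2 * δ) * Real.log 2 := by
    have : (1 - 2 * δ) * ((δ - 1 / 3) / (1 - δ)) ≤
        (21 / 31 - 2 * δ) * Real.log 2 - 2 / 3 + 2 * δ := by
      rw [← mul_div_assoc, div_le_iff₀ h1]
      have hlo : 0.693147 - 2 * δ * 0.693148 ≤ Real.log 2 * (1 - 2 * δ) := by
        nlinarith
      have : 21 / 31 * 0.693147 - 2 * δ * 0.693148 ≤ (21 / 31 - 2 * δ) * Real.log 2 := by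
        nlinarith
      -- The difference of the two sides is bounded below by a convex quadratic whose small positive
      -- minimum lies near `δ = 0.309`; the squares are centred around it.
      nlinarith [sq_nonneg (δ - 0.3), sq_nonneg (δ - 0.31), sq_nonneg (δ - 0.29)]
    linarith
  rw [e1, e2]
  nlinarith

/-- Data processing for the partition into `C` and `N`, with `exp (-Λ)` as the density of the
alternative. Its total mass is only assumed to be at most one, since the learner may fail to stop on
the alternative. -/
theorem binary_kl_le_integral {Ω : Type*} [MeasurableSpace Ω] {P : Measure Ω}
    [IsProbabilityMeasure P] {Λ : Ω → ℝ} (hΛ : Integrable Λ P) {C N : Set Ω}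
    (hC : MeasurableSet C) (hN : MeasurableSet N) (hd : Disjoint C N)
    (hcover : ∀ᵐ ω ∂P, ω ∈ C ∪ N) {δ : ℝ} (hδ : 0 < δ) (hδ' : δ < 1 / 2)
    (hPC : ENNReal.ofReal (1 - δ) ≤ P C)
    (hQC : ∫⁻ ω in C, ENNReal.ofReal (Real.exp (-Λ ω)) ∂P ≤ ENNReal.ofReal δ)
    (hQ : ∫⁻ ω in C, ENNReal.ofReal (Real.exp (-Λ ω)) ∂P +
      ∫⁻ ω in N, ENNReal.ofReal (Real.exp (-Λ ω)) ∂P ≤ 1) :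
    (1 - 2 * δ) * Real.log ((1 - δ) / δ) ≤ ∫ ω, Λ ω ∂P := by
  set c := Real.log ((1 - δ) / δ) with hc
  have h1 : 0 < 1 - δ := by linarith
  have hcpos : 0 ≤ c := Real.log_nonneg (by rw [le_div_iff₀ hδ]; linarith)
  have hec : Real.exp c = (1 - δ) / δ := Real.exp_log (by positivity)
  have hec' : Real.exp (-c) = δ / (1 - δ) := by rw [Real.exp_neg, hec, inv_div]
  have hmeas : AEStronglyMeasurable (fun ω => Real.exp (-Λ ω)) P :=
    (Real.continuous_exp.comp continuous_neg).comp_aestronglyMeasurable hΛ.1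
  have hint : ∀ S : Set Ω, ∫⁻ ω in S, ENNReal.ofReal (Real.exp (-Λ ω)) ∂P ≤ 1 →
      IntegrableOn (fun ω => Real.exp (-Λ ω)) S P ∧
      ∫⁻ ω in S, ENNReal.ofReal (Real.exp (-Λ ω)) ∂P =
        ENNReal.ofReal (∫ ω in S, Real.exp (-Λ ω) ∂P) := by
    intro S hS
    have hI : IntegrableOn (fun ω => Real.exp (-Λ ω)) S P := by
      refine ⟨hmeas.restrict, ?_⟩
      rw [hasFiniteIntegral_iff_ofReal (ae_of_all _ fun ω => (Real.exp_pos _).le)]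
      exact hS.trans_lt ENNReal.one_lt_top
    exact ⟨hI, (ofReal_integral_eq_lintegral_ofReal hI
      (ae_of_all _ fun ω => (Real.exp_pos _).le)).symm⟩
  obtain ⟨iC, eC⟩ := hint C (le_self_add.trans hQ)
  obtain ⟨iN, eN⟩ := hint N (le_add_self.trans hQ)
  set q := ∫ ω in C, Real.exp (-Λ ω) ∂P
  set q' := ∫ ω in N, Real.exp (-Λ ω) ∂P
  have hq0 : 0 ≤ q := integral_nonneg fun ω => (Real.exp_pos _).le
  have hq0' : 0 ≤ q' := integral_nonneg fun ω => (Real.exp_pos _).le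
  have hq : q ≤ δ := by
    rw [eC] at hQC
    exact (ENNReal.ofReal_le_ofReal_iff hδ.le).1 hQC
  have hqq : q + q' ≤ 1 := by
    rw [eC, eN, ← ENNReal.ofReal_add hq0 hq0'] at hQ
    simpa using ENNReal.ofReal_le_one.1 hQ
  have hp : 1 - δ ≤ P.real C := by
    have := ENNReal.toReal_mono (measure_ne_top P C) hPC
    rwa [ENNReal.toReal_ofReal h1.le] at this
  have hpN : P.real C + P.real N = 1 := by
    rw [← measureReal_union hd hN]
    have : P (C ∪ N) = 1 := (prob_compl_eq_zero_iff (hC.union hN)).1 hcover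
    simp [measureReal_def, this]
  have hu : ∫ ω, Λ ω ∂P = ∫ ω in C, Λ ω ∂P + ∫ ω in N, Λ ω ∂P := by
    rw [← setIntegral_union hd hN hΛ.integrableOn hΛ.integrableOn,
      setIntegral_eq_integral_of_ae_compl_eq_zero]
    filter_upwards [hcover] with ω h h'
    exact absurd h h'
  -- The tangent bound `1 + (a - Λ) ≤ exp (a - Λ)` replaces Jensen's inequality. It is used with `a
  -- = c` on `C` and `a = -c` on `N`, the log-ratios of the extremal case `(1 - δ, δ)` against `(δ,
  -- 1 - δ)`.
  have hlow : ∀ (S : Set Ω) (a : ℝ), IntegrableOn (fun ω => Real.exp (-Λ ω)) S P →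
      P.real S * (a + 1) - Real.exp a * ∫ ω in S, Real.exp (-Λ ω) ∂P ≤ ∫ ω in S, Λ ω ∂P := by
    intro S a hS
    have : P.real S * (a + 1) - Real.exp a * ∫ ω in S, Real.exp (-Λ ω) ∂P =
        ∫ ω in S, ((a + 1) - Real.exp a * Real.exp (-Λ ω)) ∂P := by
      rw [integral_sub (integrable_const _) (hS.const_mul _), integral_const_mul]
      simp
    rw [this]
    refine integral_mono ((integrable_const _).sub (hS.const_mul _)) hΛ.integrableOn fun ω => ?_
    have := Real.add_one_le_exp (a + -Λ ω)
    rw [Real.exp_add] at this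
    dsimp only
    linarith
  have lC := hlow C c iC
  have lN := hlow N (-c) iN
  rw [hec] at lC
  rw [hec'] at lN
  -- The left side is largest at `q = δ`, `q' = 1 - δ`, where it equals one.
  have hr : (1 - δ) / δ * q + δ / (1 - δ) * q' ≤ 1 := by
    have hq2 : δ / (1 - δ) * q' ≤ δ / (1 - δ) * (1 - q) :=
      mul_le_mul_of_nonneg_left (by linarith) (by positivity)
    have hcoef : 0 ≤ (1 - δ) / δ - δ / (1 - δ) := by
      rw [sub_nonneg, div_le_div_iff₀ h1 hδ]
      nlinarith
    have h3 : ((1 - δ) / δ - δ / (1 - δ)) * q ≤ ((1 - δ) / δ - δ / (1 - δ)) * δ :=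
      mul_le_mul_of_nonneg_left hq hcoef
    have h4 : ((1 - δ) / δ - δ / (1 - δ)) * δ + δ / (1 - δ) = 1 := by
      field_simp
      ring
    linarith
  have hfin : (1 - 2 * δ) * c ≤ (P.real C - P.real N) * c :=
    mul_le_mul_of_nonneg_right (by linarith) hcpos
  rw [hu]
  nlinarith

/-! ### Cheapest perturbations for a design matrix -/

section Design

variable {d : ℕ}

/-- The quadratic form of a matrix. -/
def quadForm (A : Matrix (Fin d) (Fin d) ℝ) (η : Vec d) : ℝ := η.ofLp ⬝ᵥ A.mulVec η.ofLp

/-- The range of a symmetric matrix is the orthogonal complement of its kernel. -/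
theorem exists_kernel_of_not_range {A : Matrix (Fin d) (Fin d) ℝ} (hA : A.IsSymm) {y : Fin d → ℝ}
    (hy : ∀ v, A.mulVec v ≠ y) : ∃ u, A.mulVec u = 0 ∧ y ⬝ᵥ u ≠ 0 := by
  by_contra! h
  have hH : A.IsHermitian := by
    rw [Matrix.IsHermitian, Matrix.conjTranspose_eq_transpose_of_trivial]; exact hA
  have hs : (Matrix.toEuclideanLin A).IsSymmetric := Matrix.isSymmetric_toEuclideanLin_iff.2 hH
  have hmem : WithLp.toLp 2 y ∈ (LinearMap.range (Matrix.toEuclideanLin A))ᗮᗮ := by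
    rw [Submodule.mem_orthogonal]
    intro u hu
    rw [hs.orthogonal_range] at hu
    have hu' : A.mulVec u.ofLp = 0 := by
      have := congrArg WithLp.ofLp (LinearMap.mem_ker.1 hu)
      simpa using this
    have := h _ hu'
    simpa [PiLp.inner_apply, dotProduct, mul_comm] using this
  rw [Submodule.orthogonal_orthogonal] at hmem
  obtain ⟨v, hv⟩ := hmem
  refine hy v.ofLp ?_
  have := congrArg WithLp.ofLp hv
  simpa using this

/-- If `A v = y`, the multiple of `v` with `yᵀη = s` has quadratic form `s² / yᵀv`. If `y` is
outside the range, a kernel direction moves `yᵀη` at no cost, matching an infinite norm. -/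
theorem exists_perturbation_of_lt_ratio {A : Matrix (Fin d) (Fin d) ℝ} (hA : A.PosSemidef)
    {y : Vec d} {R c : ℝ} (hR : 0 ≤ R) (hc : 0 < c)
    (h : ENNReal.ofReal R < ratio (invNormSq A y) (c ^ 2)) :
    ∃ η : Vec d, c < inner ℝ y η ∧ R * quadForm A η < 1 := by
  have hS : A.IsSymm := by
    have := hA.1
    rwa [Matrix.IsHermitian, Matrix.conjTranspose_eq_transpose_of_trivial] at this
  have hin : ∀ a b : Vec d, (inner ℝ a b : ℝ) = a.ofLp ⬝ᵥ b.ofLp := fun a b => by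
    simp [PiLp.inner_apply, dotProduct, mul_comm]
  by_cases hy : ∃ v, A.mulVec v = y.ofLp
  · obtain ⟨v, hv⟩ := hy
    have hc2 : 0 < c ^ 2 := by positivity
    rw [ratio, if_neg hc2.ne', ENNReal.lt_div_iff_mul_lt (by simp) (by simp),
      ← ENNReal.ofReal_mul hR] at h
    have h' := h.trans_le (iInf₂_le v hv)
    set N := y.ofLp ⬝ᵥ v with hN
    have hlt : R * c ^ 2 < N := (ENNReal.ofReal_lt_ofReal_iff').1 h' |>.1
    have hNpos : 0 < N := lt_of_le_of_lt (by positivity) hlt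
    -- The strict inequality in `h` leaves room to overshoot `c`.
    obtain ⟨s, hs, hsN⟩ : ∃ s, c < s ∧ R * s ^ 2 < N := by
      have hcont : Filter.Tendsto (fun s : ℝ => R * s ^ 2) (nhdsWithin c (Set.Ioi c))
          (nhds (R * c ^ 2)) :=
        ((by fun_prop : Continuous fun s : ℝ => R * s ^ 2).tendsto c).mono_left inf_le_left
      obtain ⟨s, h1, h2⟩ := ((hcont.eventually_lt_const hlt).and self_mem_nhdsWithin).exists
      exact ⟨s, h2, h1⟩
    refine ⟨WithLp.toLp 2 ((s / N) • v), ?_, ?_⟩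
    · rw [hin]
      simp only [dotProduct_smul, smul_eq_mul, ← hN]
      rwa [div_mul_cancel₀ _ hNpos.ne']
    · have : quadForm A (WithLp.toLp 2 ((s / N) • v)) = s ^ 2 / N := by
        simp only [quadForm, Matrix.mulVec_smul, hv, dotProduct_smul, smul_dotProduct, smul_eq_mul]
        rw [dotProduct_comm, ← hN]
        field_simp
      rw [this, ← mul_div_assoc, div_lt_one hNpos]
      exact hsN
  · push Not at hy
    obtain ⟨u, hu, hyu⟩ := exists_kernel_of_not_range hS hy
    refine ⟨WithLp.toLp 2 (((c + 1) / (y.ofLp ⬝ᵥ u)) • u), ?_, ?_⟩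
    · rw [hin]
      simp only [dotProduct_smul, smul_eq_mul]
      rw [div_mul_cancel₀ _ hyu]
      linarith
    · simp [quadForm, Matrix.mulVec_smul, hu]

theorem exists_pos_perturbation (A : Matrix (Fin d) (Fin d) ℝ) {y : Vec d} (hy : y ≠ 0) (R : ℝ) :
    ∃ η : Vec d, 0 < (inner ℝ y η : ℝ) ∧ R * quadForm A η < 1 := by
  have hq : ∀ s : ℝ, quadForm A (s • y) = s ^ 2 * quadForm A y := fun s => by
    simp only [quadForm, WithLp.ofLp_smul, Matrix.mulVec_smul, dotProduct_smul, smul_dotProduct,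
      smul_eq_mul]
    ring
  have hcont : Filter.Tendsto (fun s : ℝ => R * (s ^ 2 * quadForm A y))
      (nhdsWithin 0 (Set.Ioi 0)) (nhds (R * ((0 : ℝ) ^ 2 * quadForm A y))) :=
    ((by fun_prop : Continuous fun s : ℝ => R * (s ^ 2 * quadForm A y)).tendsto 0).mono_left
      inf_le_left
  obtain ⟨s, h1, h2⟩ := ((hcont.eventually_lt_const (u := 1) (by simp)).and
    self_mem_nhdsWithin).exists
  refine ⟨s • y, ?_, by rw [hq]; exact h1⟩
  rw [inner_smul_right]
  exact mul_pos h2 (real_inner_self_pos.2 hy)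

theorem exists_perturbation {A : Matrix (Fin d) (Fin d) ℝ} (hA : A.PosSemidef)
    {y : Vec d} {R x : ℝ} (hR : 0 ≤ R) (hy : y ≠ 0)
    (h : ENNReal.ofReal R < ratio (invNormSq A y) (pos x ^ 2)) :
    ∃ η : Vec d, x < inner ℝ y η ∧ R * quadForm A η < 1 := by
  rcases le_or_gt x 0 with hx | hx
  · obtain ⟨η, h1, h2⟩ := exists_pos_perturbation A hy R
    exact ⟨η, hx.trans_lt h1, h2⟩
  · rw [pos, max_eq_left hx.le] at h
    exact exists_perturbation_of_lt_ratio hA hR hx h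

/-- For a nonpositive threshold the zero perturbation suffices, so `y = 0` is allowed. This is
needed for the safety constraint, where the arm itself plays the role of `y` and may be zero. -/
theorem exists_weak_perturbation {A : Matrix (Fin d) (Fin d) ℝ} (hA : A.PosSemidef)
    {y : Vec d} {R x : ℝ} (hR : 0 ≤ R)
    (h : ENNReal.ofReal R < ratio (invNormSq A y) (pos x ^ 2)) :
    ∃ η : Vec d, x ≤ inner ℝ y η ∧ R * quadForm A η < 1 := by
  rcases le_or_gt x 0 with hx | hx
  · exact ⟨0, by simpa using hx, by simp [quadForm]⟩
  · rw [pos, max_eq_left hx.le] at h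
    obtain ⟨η, h1, h2⟩ := exists_perturbation_of_lt_ratio hA hR hx h
    exact ⟨η, h1.le, h2⟩

theorem quadForm_designMatrix (X : Finset (Vec d)) (lam : X → ℝ) (η : Vec d) :
    quadForm (designMatrix X lam) η = ∑ x : X, lam x * (inner ℝ η (x : Vec d)) ^ 2 := by
  rw [quadForm, designMatrix, Matrix.sum_mulVec, dotProduct_sum]
  refine Finset.sum_congr rfl fun x _ => ?_
  rw [Matrix.smul_mulVec, Matrix.vecMulVec_mulVec]
  have hin : (inner ℝ η (x : Vec d) : ℝ) = (x : Vec d).ofLp ⬝ᵥ η.ofLp := by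
    simp [PiLp.inner_apply, dotProduct]
  simp only [dotProduct_smul, smul_eq_mul, hin, MulOpposite.smul_eq_mul_unop,
    MulOpposite.unop_op]
  rw [dotProduct_comm η.ofLp]
  ring

theorem posSemidef_designMatrix (X : Finset (Vec d)) {lam : X → ℝ} (h : ∀ x, 0 ≤ lam x) :
    (designMatrix X lam).PosSemidef := by
  refine Matrix.posSemidef_sum _ fun x _ => Matrix.PosSemidef.smul ?_ (h x)
  simpa using Matrix.posSemidef_vecMulVec_self_star (x : Vec d).ofLp

end Design

/-! ### Likelihood ratio of a single round -/

/-- The law of the noise of one round. -/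
noncomputable abbrev noise : Measure (ℝ × ℝ) := (gaussianReal 0 1).prod (gaussianReal 0 1)

/-- The exponential is the density of `N(m', 1)` relative to `N(m, 1)` at `m + w`, so both instances
are expressed through the same noise `w`. -/
theorem lintegral_gaussianReal_shift (m m' : ℝ) {f : ℝ → ℝ≥0∞} (hf : Measurable f) :
    ∫⁻ w, f (m' + w) ∂gaussianReal 0 1 =
      ∫⁻ w, f (m + w) * ENNReal.ofReal (Real.exp (-((m - m') * w + (m - m') ^ 2 / 2)))
        ∂gaussianReal 0 1 := by
  have hmap : ∀ (k : ℝ) {g : ℝ → ℝ≥0∞}, Measurable g →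
      ∫⁻ w, g (k + w) ∂gaussianReal 0 1 = ∫⁻ r, gaussianPDF k 1 r * g r := by
    intro k g hg
    rw [← lintegral_map (f := g) (g := fun w => k + w) hg (by fun_prop), gaussianReal_map_const_add,
      zero_add, gaussianReal_of_var_ne_zero _ one_ne_zero,
      lintegral_withDensity_eq_lintegral_mul _ (by fun_prop) hg]
    rfl
  rw [hmap m' hf]
  have h2 := hmap m (g := fun r => f r *
    ENNReal.ofReal (Real.exp (-((m - m') * (r - m) + (m - m') ^ 2 / 2)))) (by fun_prop)
  simp only [add_sub_cancel_left] at h2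
  rw [h2]
  refine lintegral_congr fun r => ?_
  rw [mul_left_comm, mul_comm _ (f r)]
  congr 1
  rw [gaussianPDF, gaussianPDF, ← ENNReal.ofReal_mul (gaussianPDFReal_nonneg _ _ _)]
  congr 1
  rw [gaussianPDFReal, gaussianPDFReal, mul_assoc _ (Real.exp _), ← Real.exp_add]
  congr 2
  push_cast
  ring

/-- The log-likelihood ratio of one round, as a function of the noise, when the mean rewards of
the two instances differ by `a` and their mean safety values differ by `b`. -/
noncomputable def logRatio (a b : ℝ) (w : ℝ × ℝ) : ℝ :=
  (a * w.1 + a ^ 2 / 2) + (b * w.2 + b ^ 2 / 2)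

theorem measurable_logRatio (a b : ℝ) : Measurable (logRatio a b) := by
  unfold logRatio
  fun_prop

theorem integrable_id_gaussian : Integrable (fun x : ℝ => x) (gaussianReal 0 1) :=
  (memLp_id_gaussianReal' 1 (by simp)).integrable le_rfl

theorem integrable_logRatio (a b : ℝ) : Integrable (logRatio a b) noise := by
  have h1 : Integrable (fun w : ℝ × ℝ => w.1) noise := integrable_id_gaussian.comp_fst _
  have h2 : Integrable (fun w : ℝ × ℝ => w.2) noise := integrable_id_gaussian.comp_snd _
  exact ((h1.const_mul a).add (integrable_const _)).add
    ((h2.const_mul b).add (integrable_const _))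

theorem integral_logRatio (a b : ℝ) : ∫ w, logRatio a b w ∂noise = (a ^ 2 + b ^ 2) / 2 := by
  have h1 : Integrable (fun w : ℝ × ℝ => w.1) noise := integrable_id_gaussian.comp_fst _
  have h2 : Integrable (fun w : ℝ × ℝ => w.2) noise := integrable_id_gaussian.comp_snd _
  have e1 : ∫ w : ℝ × ℝ, w.1 ∂noise = 0 := by
    have := integral_fun_fst (μ := gaussianReal 0 1) (ν := gaussianReal 0 1) (fun x : ℝ => x)
    simpa using this
  have e2 : ∫ w : ℝ × ℝ, w.2 ∂noise = 0 := by
    have := integral_fun_snd (μ := gaussianReal 0 1) (ν := gaussianReal 0 1) (fun x : ℝ => x)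
    simpa using this
  have ha : Integrable (fun w : ℝ × ℝ => a * w.1 + a ^ 2 / 2) noise :=
    (h1.const_mul a).add (integrable_const _)
  have hb : Integrable (fun w : ℝ × ℝ => b * w.2 + b ^ 2 / 2) noise :=
    (h2.const_mul b).add (integrable_const _)
  unfold logRatio
  rw [integral_add ha hb, integral_add (h1.const_mul a) (integrable_const _),
    integral_add (h2.const_mul b) (integrable_const _), integral_const_mul, integral_const_mul,
    e1, e2]
  simp
  ring

theorem lintegral_noise_shift (m m' k k' : ℝ) {f : ℝ × ℝ → ℝ≥0∞} (hf : Measurable f) :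
    ∫⁻ w, f (m' + w.1, k' + w.2) ∂noise =
      ∫⁻ w, f (m + w.1, k + w.2) * ENNReal.ofReal (Real.exp (-logRatio (m - m') (k - k') w))
        ∂noise := by
  have hl := measurable_logRatio (m - m') (k - k')
  rw [lintegral_prod _ (by fun_prop), lintegral_prod _ (by fun_prop)]
  have h1 : ∀ v : ℝ, ∫⁻ w, f (m' + v, k' + w) ∂gaussianReal 0 1 =
      ∫⁻ w, f (m' + v, k + w) * ENNReal.ofReal (Real.exp (-((k - k') * w + (k - k') ^ 2 / 2)))
        ∂gaussianReal 0 1 := fun v =>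
    lintegral_gaussianReal_shift k k' (f := fun r => f (m' + v, r)) (by fun_prop)
  simp only [h1]
  rw [lintegral_gaussianReal_shift m m' (f := fun r => ∫⁻ w, f (r, k + w) *
    ENNReal.ofReal (Real.exp (-((k - k') * w + (k - k') ^ 2 / 2))) ∂gaussianReal 0 1)
    (Measurable.lintegral_prod_right' (f := fun p : ℝ × ℝ => f (p.1, k + p.2) *
    ENNReal.ofReal (Real.exp (-((k - k') * p.2 + (k - k') ^ 2 / 2)))) (by fun_prop))]
  refine lintegral_congr fun v => ?_
  rw [← lintegral_mul_const _ (by fun_prop)]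
  refine lintegral_congr fun w => ?_
  rw [mul_assoc, ← ENNReal.ofReal_mul (Real.exp_pos _).le, ← Real.exp_add, logRatio]
  congr 4
  ring

/-! ### Histories and their independence of future noise -/

namespace Learner

variable {d : ℕ} {X Z : Finset (Vec d)} (L : Learner.{u} X Z) (θ μ θ' μ' : Vec d)

instance : IsProbabilityMeasure L.law := by
  unfold law
  infer_instance

/-- What the learner knows after `n` rounds: its seed and the history. -/
noncomputable def state (n : ℕ) (ω : L.Omega) : L.Seed × Hist d n := (ω.1, L.history θ μ ω n)

/-- The round appended to the history when the noise is `w`. -/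
noncomputable def round (n : ℕ) (h : L.Seed × Hist d n) (w : ℝ × ℝ) : Vec d × ℝ × ℝ :=
  ((L.action n h : Vec d), inner ℝ θ (L.action n h : Vec d) + w.1,
    inner ℝ μ (L.action n h : Vec d) + w.2)

theorem measurable_round (n : ℕ) :
    Measurable fun p : (L.Seed × Hist d n) × (ℝ × ℝ) => L.round θ μ n p.1 p.2 := by
  have ha : Measurable fun p : (L.Seed × Hist d n) × (ℝ × ℝ) => (L.action n p.1 : Vec d) :=
    measurable_subtype_coe.comp ((L.measurable_action n).comp measurable_fst)
  unfold round
  exact ha.prodMk (((measurable_const.inner ha).add (by fun_prop)).prodMk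
    ((measurable_const.inner ha).add (by fun_prop)))

theorem measurable_snoc (d n : ℕ) : Measurable fun p : Hist d n × (Vec d × ℝ × ℝ) =>
    (Fin.snoc (α := fun _ => Vec d × ℝ × ℝ) p.1 p.2 : Hist d (n + 1)) := by
  refine measurable_pi_iff.2 fun i => ?_
  induction i using Fin.lastCases with
  | last => simpa using measurable_snd
  | cast i =>
    simp only [Fin.snoc_castSucc]
    exact (measurable_pi_apply i).comp measurable_fst

theorem measurable_state (n : ℕ) : Measurable (L.state θ μ n) := by
  induction n with
  | zero =>
    refine measurable_fst.prodMk (measurable_pi_iff.2 fun i => i.elim0)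
  | succ n ih =>
    have h1 : Measurable fun ω : L.Omega => ω.2 n := by fun_prop
    have h2 : Measurable fun ω : L.Omega => L.history θ μ ω n := measurable_snd.comp ih
    have h3 := (L.measurable_round θ μ n).comp (ih.prodMk h1)
    exact measurable_fst.prodMk ((measurable_snoc d n).comp (h2.prodMk h3))

theorem history_castLE (ω : L.Omega) {k n : ℕ} (hkn : k ≤ n) :
    (fun i : Fin k => L.history θ μ ω n (Fin.castLE hkn i)) = L.history θ μ ω k := by
  induction n, hkn using Nat.le_induction with
  | base => rfl
  | succ n hn ih =>
    rw [← ih]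
    funext i
    have : Fin.castLE (Nat.le_succ_of_le hn) i = Fin.castSucc (Fin.castLE hn i) := rfl
    rw [this]
    exact Fin.snoc_castSucc (α := fun _ => Vec d × ℝ × ℝ) _ _ _

theorem history_congr {ω ω' : L.Omega} (n : ℕ) (h1 : ω.1 = ω'.1) (h : ∀ i < n, ω.2 i = ω'.2 i) :
    L.history θ μ ω n = L.history θ μ ω' n := by
  induction n with
  | zero => rfl
  | succ n ih =>
    simp only [history]
    rw [ih fun i hi => h i (by omega), h n (by omega), h1]

/-- Extend finitely many noise values by zero. -/
def extendNoise (n : ℕ) (v : Finset.range n → ℝ × ℝ) (i : ℕ) : ℝ × ℝ :=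
  if h : i ∈ Finset.range n then v ⟨i, h⟩ else 0

theorem measurable_extendNoise (n : ℕ) : Measurable (extendNoise n) := by
  refine measurable_pi_iff.2 fun i => ?_
  unfold extendNoise
  split_ifs with h
  · exact measurable_pi_apply _
  · exact measurable_const

theorem state_eq_extendNoise (n : ℕ) (ω : L.Omega) :
    L.state θ μ n ω = L.state θ μ n (ω.1, extendNoise n ((Finset.range n).restrict ω.2)) := by
  refine Prod.ext rfl (L.history_congr θ μ n rfl fun i hi => ?_)
  simp [extendNoise, hi]

/-- The state after `n` rounds is a function of the seed and the noise with indices below `n`, hence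
independent of the noise with index `n`. -/
theorem map_state_noise (n : ℕ) :
    L.law.map (fun ω => (L.state θ μ n ω, ω.2 n)) = (L.law.map (L.state θ μ n)).prod noise := by
  set P := Measure.infinitePi fun _ : ℕ => noise with hP
  have hX : ∀ i : ℕ, Measurable fun ω : ℕ → ℝ × ℝ => ω i := fun i => measurable_pi_apply i
  have hind : iIndepFun (fun (i : ℕ) (ω : ℕ → ℝ × ℝ) => ω i) P :=
    iIndepFun_infinitePi (P := fun _ : ℕ => noise) (X := fun _ x => x) fun _ => measurable_id
  have h2 : IndepFun (fun ω : ℕ → ℝ × ℝ => (Finset.range n).restrict ω) (fun ω => ω n) P := by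
    have := hind.indepFun_finset (Finset.range n) {n} (by simp) hX
    exact this.comp (φ := id) (ψ := fun v : ({n} : Finset ℕ) → ℝ × ℝ => v ⟨n, by simp⟩)
      measurable_id (measurable_pi_apply _)
  have hr : Measurable fun ω : ℕ → ℝ × ℝ => (Finset.range n).restrict ω := by fun_prop
  have h3 := (indepFun_iff_map_prod_eq_prod_map_map hr.aemeasurable (hX n).aemeasurable).1 h2
  have hn : P.map (fun ω => ω n) = noise := Measure.infinitePi_map_eval _ n
  rw [hn] at h3
  have hlaw : L.law = L.seedLaw.prod P := rfl
  set Q := P.map fun ω : ℕ → ℝ × ℝ => (Finset.range n).restrict ω with hQ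
  have : IsProbabilityMeasure Q := Measure.isProbabilityMeasure_map hr.aemeasurable
  let F : L.Seed × (Finset.range n → ℝ × ℝ) → L.Seed × Hist d n :=
    fun p => L.state θ μ n (p.1, extendNoise n p.2)
  have hF : Measurable F := (L.measurable_state θ μ n).comp
    (measurable_fst.prodMk ((measurable_extendNoise n).comp measurable_snd))
  have hstate : L.state θ μ n = F ∘ Prod.map id fun ω => (Finset.range n).restrict ω := by
    funext ω
    exact L.state_eq_extendNoise θ μ n ω
  have hS : L.law.map (L.state θ μ n) = (L.seedLaw.prod Q).map F := by
    rw [hstate, ← Measure.map_map hF (by fun_prop), hlaw, ← Measure.map_prod_map _ _ measurable_id hr,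
      Measure.map_id]
  have hJ : (fun ω : L.Omega => (L.state θ μ n ω, ω.2 n)) =
      (Prod.map F id ∘ MeasurableEquiv.prodAssoc.symm) ∘
        Prod.map id fun ω => ((Finset.range n).restrict ω, ω n) := by
    funext ω
    exact Prod.ext (L.state_eq_extendNoise θ μ n ω) rfl
  rw [hS, hJ, ← Measure.map_map (by fun_prop) (by fun_prop), hlaw,
    ← Measure.map_prod_map _ _ measurable_id (by fun_prop), h3, Measure.map_id,
    ← Measure.map_map (by fun_prop) (by fun_prop)]
  have hassoc : (L.seedLaw.prod (Q.prod noise)).map MeasurableEquiv.prodAssoc.symm =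
      (L.seedLaw.prod Q).prod noise := by
    rw [← Measure.prodAssoc_prod, Measure.map_map (by fun_prop) (by fun_prop)]
    simp
  rw [hassoc, ← Measure.map_prod_map _ _ hF measurable_id, Measure.map_id]

/-! ### Change of measure after finitely many rounds -/

/-- The log-likelihood ratio of the first `n` rounds between the instances `(θ, μ)` and
`(θ', μ')`, as a function of the sample point on the instance `(θ, μ)`. -/
noncomputable def logLik (n : ℕ) (ω : L.Omega) : ℝ :=
  ∑ t ∈ Finset.range n, logRatio (inner ℝ (θ - θ') (L.action t (L.state θ μ t ω) : Vec d))
    (inner ℝ (μ - μ') (L.action t (L.state θ μ t ω) : Vec d)) (ω.2 t)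

/-- The log-likelihood ratio of one round as a function of the observations. -/
noncomputable def roundLik (y : Vec d × ℝ × ℝ) : ℝ :=
  logRatio (inner ℝ (θ - θ') y.1) (inner ℝ (μ - μ') y.1)
    (y.2.1 - inner ℝ θ y.1, y.2.2 - inner ℝ μ y.1)

theorem measurable_roundLik : Measurable (roundLik θ μ θ' μ') := by
  unfold roundLik logRatio
  have h : ∀ v : Vec d, Measurable fun y : Vec d × ℝ × ℝ => (inner ℝ v y.1 : ℝ) := fun v =>
    measurable_const.inner measurable_fst
  have h1 := h (θ - θ')
  have h2 := h (μ - μ')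
  have h3 := h θ
  have h4 := h μ
  fun_prop

/-- The log-likelihood ratio as a function of the history. -/
noncomputable def histLik {n : ℕ} (h : Hist d n) : ℝ := ∑ i, roundLik θ μ θ' μ' (h i)

theorem measurable_histLik (n : ℕ) : Measurable (histLik θ μ θ' μ' (n := n)) := by
  have := measurable_roundLik θ μ θ' μ'
  unfold histLik
  fun_prop

theorem histLik_snoc {n : ℕ} (h : Hist d n) (y : Vec d × ℝ × ℝ) :
    histLik θ μ θ' μ' (Fin.snoc (α := fun _ => Vec d × ℝ × ℝ) h y : Hist d (n + 1)) =
      histLik θ μ θ' μ' h + roundLik θ μ θ' μ' y := by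
  simp [histLik, Fin.sum_univ_castSucc]

theorem roundLik_round (n : ℕ) (h : L.Seed × Hist d n) (w : ℝ × ℝ) :
    roundLik θ μ θ' μ' (L.round θ μ n h w) = logRatio (inner ℝ (θ - θ') (L.action n h : Vec d))
      (inner ℝ (μ - μ') (L.action n h : Vec d)) w := by
  simp [roundLik, round]

theorem histLik_history (n : ℕ) (ω : L.Omega) :
    histLik θ μ θ' μ' (L.history θ μ ω n) = L.logLik θ μ θ' μ' n ω := by
  induction n with
  | zero => simp [histLik, logLik]
  | succ n ih =>
    have h1 : L.history θ μ ω (n + 1) = Fin.snoc (α := fun _ => Vec d × ℝ × ℝ)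
      (L.history θ μ ω n) (L.round θ μ n (L.state θ μ n ω) (ω.2 n)) := rfl
    rw [h1, histLik_snoc, ih, roundLik_round, logLik, logLik, Finset.sum_range_succ]

theorem lintegral_state_succ (n : ℕ) {f : L.Seed × Hist d (n + 1) → ℝ≥0∞} (hf : Measurable f) :
    ∫⁻ ω, f (L.state θ μ (n + 1) ω) ∂L.law = ∫⁻ ω, ∫⁻ w, f ((L.state θ μ n ω).1,
      Fin.snoc (α := fun _ => Vec d × ℝ × ℝ) (L.state θ μ n ω).2
        (L.round θ μ n (L.state θ μ n ω) w)) ∂noise ∂L.law := by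
  have hr := L.measurable_round θ μ n
  have hg : Measurable fun p : (L.Seed × Hist d n) × (ℝ × ℝ) => f (p.1.1,
      Fin.snoc (α := fun _ => Vec d × ℝ × ℝ) p.1.2 (L.round θ μ n p.1 p.2)) :=
    hf.comp ((measurable_fst.comp measurable_fst).prodMk ((measurable_snoc d n).comp
      ((measurable_snd.comp measurable_fst).prodMk hr)))
  have hs := L.measurable_state θ μ n
  have hm : Measurable fun ω : L.Omega => (L.state θ μ n ω, ω.2 n) := hs.prodMk (by fun_prop)
  have e := lintegral_map (μ := L.law) hg hm
  have : IsProbabilityMeasure (L.law.map (L.state θ μ n)) :=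
    Measure.isProbabilityMeasure_map hs.aemeasurable
  rw [map_state_noise, lintegral_prod _ hg.aemeasurable,
    lintegral_map hg.lintegral_prod_right' hs] at e
  exact e.symm

/-- Induction on `n`: the last round is integrated out given the past, where it is a Gaussian shift
with a known action. Writing the likelihood through the history lets the induction hypothesis apply
to the conditional integral. -/
theorem lintegral_state_change (n : ℕ) {f : L.Seed × Hist d n → ℝ≥0∞} (hf : Measurable f) :
    ∫⁻ ω, f (L.state θ' μ' n ω) ∂L.law =
      ∫⁻ ω, f (L.state θ μ n ω) * ENNReal.ofReal (Real.exp (-L.logLik θ μ θ' μ' n ω)) ∂L.law := by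
  simp only [← histLik_history]
  induction n with
  | zero =>
    simp only [histLik, Finset.univ_eq_empty, Finset.sum_empty, neg_zero, Real.exp_zero,
      ENNReal.ofReal_one, mul_one]
    rfl
  | succ n ih =>
    have hl := measurable_histLik θ μ θ' μ' (n + 1)
    have hl' := measurable_histLik θ μ θ' μ' n
    have hr := L.measurable_round θ' μ' n
    have hsn := measurable_snoc d n
    have e := L.lintegral_state_succ θ μ n (f := fun p => f p *
      ENNReal.ofReal (Real.exp (-histLik θ μ θ' μ' p.2))) (by fun_prop)
    refine Eq.trans ?_ e.symm
    rw [lintegral_state_succ _ _ _ _ hf]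
    rw [ih (f := fun p => ∫⁻ w, f (p.1,
      Fin.snoc (α := fun _ => Vec d × ℝ × ℝ) p.2 (L.round θ' μ' n p w)) ∂noise)]
    · refine lintegral_congr fun ω => ?_
      set s := L.state θ μ n ω with hs
      have hs2 : L.history θ μ ω n = s.2 := rfl
      set a : Vec d := (L.action n s : Vec d) with ha
      simp only [histLik_snoc, roundLik_round, ← ha]
      have hfm : Measurable fun y : ℝ × ℝ => f (s.1,
          Fin.snoc (α := fun _ => Vec d × ℝ × ℝ) s.2 (a, y)) :=
        hf.comp (measurable_const.prodMk (hsn.comp (measurable_const.prodMk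
          (measurable_const.prodMk measurable_id))))
      have := lintegral_noise_shift (inner ℝ θ a) (inner ℝ θ' a) (inner ℝ μ a) (inner ℝ μ' a) hfm
      simp only [round, ← ha] at this ⊢
      have hlr := measurable_logRatio (inner ℝ θ a - inner ℝ θ' a) (inner ℝ μ a - inner ℝ μ' a)
      rw [this, hs2, ← lintegral_mul_const]
      · refine lintegral_congr fun w => ?_
        rw [mul_assoc, ← ENNReal.ofReal_mul (Real.exp_pos _).le, ← Real.exp_add, inner_sub_left,
          inner_sub_left, neg_add_rev]
      · have hc : Measurable fun w : ℝ × ℝ => ((inner ℝ θ a : ℝ) + w.1, (inner ℝ μ a : ℝ) + w.2) := by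
          fun_prop
        exact (hfm.comp hc).mul (by fun_prop)
    · refine Measurable.lintegral_prod_right' (f := fun p : (L.Seed × Hist d n) × (ℝ × ℝ) => f (p.1.1,
        Fin.snoc (α := fun _ => Vec d × ℝ × ℝ) p.1.2 (L.round θ' μ' n p.1 p.2))) ?_
      exact hf.comp ((measurable_fst.comp measurable_fst).prodMk (hsn.comp
        ((measurable_snd.comp measurable_fst).prodMk hr)))

/-! ### Stopping and returning as events of the history -/

/-- The information available after `k ≤ n` rounds. -/
def truncate {n k : ℕ} (hk : k ≤ n) (p : L.Seed × Hist d n) : L.Seed × Hist d k :=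
  (p.1, fun i => p.2 (Fin.castLE hk i))

theorem measurable_truncate {n k : ℕ} (hk : k ≤ n) : Measurable (L.truncate hk) := by
  unfold truncate
  fun_prop

theorem truncate_state {n k : ℕ} (hk : k ≤ n) (ω : L.Omega) :
    L.truncate hk (L.state θ μ n ω) = L.state θ μ k ω :=
  Prod.ext rfl (L.history_castLE θ μ ω hk)

/-- The learner has not stopped after `n` rounds. -/
def runSet (n : ℕ) : Set (L.Seed × Hist d n) :=
  {p | ∀ k (hk : k ≤ n), L.truncate hk p ∉ L.halt k}

/-- The learner stops after exactly `n` rounds. -/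
def stopSet (n : ℕ) : Set (L.Seed × Hist d n) :=
  {p | p ∈ L.halt n ∧ ∀ k (hk : k < n), L.truncate hk.le p ∉ L.halt k}

theorem measurableSet_runSet (n : ℕ) : MeasurableSet (L.runSet n) := by
  simp only [runSet, Set.ofPred_forall]
  exact MeasurableSet.iInter fun k => MeasurableSet.iInter fun hk =>
    (L.measurable_truncate hk (L.measurableSet_halt k)).compl

theorem measurableSet_stopSet (n : ℕ) : MeasurableSet (L.stopSet n) := by
  refine (L.measurableSet_halt n).inter ?_
  change MeasurableSet {p | ∀ k (hk : k < n), L.truncate hk.le p ∉ L.halt k}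
  simp only [Set.ofPred_forall]
  exact MeasurableSet.iInter fun k => MeasurableSet.iInter fun hk =>
    (L.measurable_truncate hk.le (L.measurableSet_halt k)).compl

theorem lt_stoppingTime_iff (n : ℕ) (ω : L.Omega) :
    (n : ℕ∞) < L.stoppingTime θ μ ω ↔ ∀ k ≤ n, L.state θ μ k ω ∉ L.halt k := by
  rw [← ENat.natCast_add_one_le_iff, stoppingTime, le_iInf₂_iff]
  refine forall_congr' fun k => ?_
  change (_ ∈ L.halt k → _) ↔ (_ → ¬ (L.state θ μ k ω ∈ L.halt k))
  have : ((n : ℕ∞) + 1 ≤ k) ↔ ¬ k ≤ n := by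
    rw [not_le, ← Nat.add_one_le_iff]
    exact_mod_cast Iff.rfl
  rw [this]
  exact ⟨fun h h1 h2 => h h2 h1, fun h h1 h2 => h h2 h1⟩

theorem state_mem_runSet_iff (n : ℕ) (ω : L.Omega) :
    L.state θ μ n ω ∈ L.runSet n ↔ (n : ℕ∞) < L.stoppingTime θ μ ω := by
  rw [lt_stoppingTime_iff]
  simp only [runSet, Set.mem_ofPred_eq, truncate_state]

theorem state_mem_stopSet_iff (n : ℕ) (ω : L.Omega) :
    L.state θ μ n ω ∈ L.stopSet n ↔ L.stoppingTime θ μ ω = n := by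
  simp only [stopSet, Set.mem_ofPred_eq, truncate_state]
  constructor
  · rintro ⟨h1, h2⟩
    refine le_antisymm (iInf₂_le n h1) (le_iInf₂ fun k hk => ?_)
    by_contra hlt
    exact h2 k (by exact_mod_cast not_le.1 hlt) hk
  · intro h
    have h2 : ∀ k < n, L.state θ μ k ω ∉ L.halt k := fun k hk =>
      (L.lt_stoppingTime_iff θ μ k ω).1 (by rw [h]; exact_mod_cast hk) k le_rfl
    refine ⟨?_, h2⟩
    by_contra h1
    have : (n : ℕ∞) < L.stoppingTime θ μ ω := by
      rw [lt_stoppingTime_iff]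
      intro k hk
      rcases hk.lt_or_eq with hk | rfl
      exacts [h2 k hk, h1]
    exact absurd h this.ne'

/-- The stopped learner returns an arm of `S`. -/
def returnSet (S : Set (Vec d)) (n : ℕ) : Set (L.Seed × Hist d n) :=
  L.stopSet n ∩ {p | ∃ z : Z, (z : Vec d) ∈ S ∧ L.recommend n p = some z}

theorem measurableSet_returnSet (S : Set (Vec d)) (n : ℕ) :
    MeasurableSet (L.returnSet S n) := by
  refine (L.measurableSet_stopSet n).inter ?_
  simp only [Set.ofPred_exists, Set.ofPred_and]
  exact MeasurableSet.iUnion fun z =>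
    (MeasurableSet.const _).inter (L.measurableSet_recommend n z)

theorem returnsIn_eq_iUnion (S : Set (Vec d)) :
    L.returnsIn θ μ S = ⋃ n, L.state θ μ n ⁻¹' L.returnSet S n := by
  ext ω
  simp only [returnsIn, returnSet, Set.mem_ofPred_eq, Set.mem_iUnion, Set.mem_preimage,
    Set.mem_inter_iff, state_mem_stopSet_iff]
  refine exists_congr fun n => ⟨?_, ?_⟩
  · rintro ⟨z, h1, h2, h3⟩
    exact ⟨h1, z, h3, h2⟩
  · rintro ⟨h1, z, h3, h2⟩
    exact ⟨z, h1, h2, h3⟩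

theorem disjoint_preimage_state {B : (n : ℕ) → Set (L.Seed × Hist d n)}
    (hB : ∀ n, B n ⊆ L.stopSet n) :
    Pairwise (Function.onFun Disjoint fun n => L.state θ μ n ⁻¹' B n) := by
  intro m n hmn
  refine Set.disjoint_left.2 fun ω h1 h2 => hmn ?_
  have e1 := (L.state_mem_stopSet_iff θ μ m ω).1 (hB m h1)
  have e2 := (L.state_mem_stopSet_iff θ μ n ω).1 (hB n h2)
  exact_mod_cast e1.symm.trans e2

/-! ### Expected numbers of plays -/

/-- The learner plays `x` in round `t`, not having stopped before. -/
def playSet (x : X) (t : ℕ) : Set (L.Seed × Hist d t) := L.runSet t ∩ L.action t ⁻¹' {x}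

theorem measurableSet_playSet (x : X) (t : ℕ) : MeasurableSet (L.playSet x t) :=
  (L.measurableSet_runSet t).inter (L.measurable_action t (measurableSet_singleton x))

/-- The event is decided before the noise of round `t` is drawn, so the expectation factorises.
Summed over rounds, this takes the place of Wald's identity. -/
theorem integral_indicator_noise (t : ℕ) {B : Set (L.Seed × Hist d t)} (hB : MeasurableSet B)
    {g : ℝ × ℝ → ℝ} (hg : Measurable g) (hgi : Integrable g noise) :
    Integrable ((L.state θ μ t ⁻¹' B).indicator fun ω => g (ω.2 t)) L.law ∧
      ∫ ω, (L.state θ μ t ⁻¹' B).indicator (fun ω => g (ω.2 t)) ω ∂L.law =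
        L.law.real (L.state θ μ t ⁻¹' B) * ∫ w, g w ∂noise := by
  have hs := L.measurable_state θ μ t
  have hm : Measurable fun ω : L.Omega => (L.state θ μ t ω, ω.2 t) := hs.prodMk (by fun_prop)
  have : IsProbabilityMeasure (L.law.map (L.state θ μ t)) :=
    Measure.isProbabilityMeasure_map hs.aemeasurable
  let G : (L.Seed × Hist d t) × (ℝ × ℝ) → ℝ := fun p => B.indicator (fun _ => 1) p.1 * g p.2
  have hb : Measurable fun p : L.Seed × Hist d t => B.indicator (fun _ => (1 : ℝ)) p :=
    measurable_const.indicator hB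
  have hG : Measurable G := (hb.comp measurable_fst).mul (hg.comp measurable_snd)
  have hbi : Integrable (fun p => B.indicator (fun _ => (1 : ℝ)) p) (L.law.map (L.state θ μ t)) :=
    (integrable_const 1).indicator hB
  have hGi : Integrable G ((L.law.map (L.state θ μ t)).prod noise) := hbi.mul_prod hgi
  have heq : ((L.state θ μ t ⁻¹' B).indicator fun ω => g (ω.2 t)) =
      fun ω : L.Omega => G (L.state θ μ t ω, ω.2 t) := by
    funext ω
    by_cases h : L.state θ μ t ω ∈ B <;> simp [G, h]
  rw [heq]
  rw [← map_state_noise] at hGi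
  refine ⟨(integrable_map_measure hG.aestronglyMeasurable hm.aemeasurable).1 hGi, ?_⟩
  have e := integral_map (μ := L.law) hm.aemeasurable hG.aestronglyMeasurable
  rw [map_state_noise] at e
  rw [← e, integral_prod_mul (fun p => B.indicator (fun _ => (1 : ℝ)) p) g,
    integral_indicator_const _ hB, map_measureReal_apply hs hB]
  simp

/-- The expected number of plays of `x`. -/
noncomputable def expectedPlays (x : X) : ℝ≥0∞ := ∑' t, L.law (L.state θ μ t ⁻¹' L.playSet x t)

theorem coe_eq_tsum_lt (τ : ℕ∞) : (τ : ℝ≥0∞) = ∑' t : ℕ, if (t : ℕ∞) < τ then 1 else 0 := by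
  cases τ with
  | top =>
    have : ∀ t : ℕ, (t : ℕ∞) < ⊤ := fun t => ENat.natCast_lt_top t
    simp only [this, if_true]
    rw [ENNReal.tsum_const_eq_top_of_ne_zero one_ne_zero]
    rfl
  | coe n =>
    rw [tsum_eq_sum (s := Finset.range n)]
    · rw [Finset.sum_congr rfl fun t ht => if_pos (by exact_mod_cast Finset.mem_range.1 ht)]
      simp
    · intro t ht
      rw [if_neg]
      simpa using ht

theorem stoppingTime_eq_tsum (ω : L.Omega) : (L.stoppingTime θ μ ω : ℝ≥0∞) =
    ∑' t, (L.state θ μ t ⁻¹' L.runSet t).indicator 1 ω := by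
  rw [coe_eq_tsum_lt]
  refine tsum_congr fun t => ?_
  simp only [Set.indicator, Set.mem_preimage, state_mem_runSet_iff, Pi.one_apply]

theorem expectedStoppingTime_eq_tsum :
    L.expectedStoppingTime θ μ = ∑' t, L.law (L.state θ μ t ⁻¹' L.runSet t) := by
  have hm : ∀ t, MeasurableSet (L.state θ μ t ⁻¹' L.runSet t) := fun t =>
    L.measurable_state θ μ t (L.measurableSet_runSet t)
  simp only [expectedStoppingTime, stoppingTime_eq_tsum]
  rw [lintegral_tsum fun t => (measurable_one.indicator (hm t)).aemeasurable]
  exact tsum_congr fun t => lintegral_indicator_one (hm t)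

theorem sum_expectedPlays : ∑ x, L.expectedPlays θ μ x = L.expectedStoppingTime θ μ := by
  simp only [expectedPlays]
  rw [expectedStoppingTime_eq_tsum, ← Summable.tsum_finsetSum fun x _ => ENNReal.summable]
  refine tsum_congr fun t => ?_
  have hU : L.state θ μ t ⁻¹' L.runSet t = ⋃ x, L.state θ μ t ⁻¹' L.playSet x t := by
    ext ω
    simp [playSet]
  rw [hU, measure_iUnion, tsum_fintype]
  · intro x y hxy
    refine Set.disjoint_left.2 fun ω h1 h2 => hxy ?_
    exact h1.2.symm.trans h2.2
  · exact fun x => L.measurable_state θ μ t (L.measurableSet_playSet x t)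

theorem expectedPlays_ne_top (hT : L.expectedStoppingTime θ μ ≠ ⊤) (x : X) :
    L.expectedPlays θ μ x ≠ ⊤ := by
  refine ne_top_of_le_ne_top hT ?_
  rw [← sum_expectedPlays]
  exact Finset.single_le_sum (f := L.expectedPlays θ μ) (fun _ _ => zero_le)
    (Finset.mem_univ x)

theorem ae_stoppingTime_ne_top (hT : L.expectedStoppingTime θ μ ≠ ⊤) :
    ∀ᵐ ω ∂L.law, L.stoppingTime θ μ ω ≠ ⊤ := by
  have hm : Measurable fun ω => (L.stoppingTime θ μ ω : ℝ≥0∞) := by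
    simp only [stoppingTime_eq_tsum]
    exact Measurable.tsum fun t => measurable_one.indicator
      (L.measurable_state θ μ t (L.measurableSet_runSet t))
  filter_upwards [ae_lt_top hm hT] with ω h h'
  simp [h'] at h

/-! ### The log-likelihood ratio at the stopping time -/

/-- The contribution of round `t` to the log-likelihood ratio if `x` is played in it. -/
noncomputable def playLik (x : X) (t : ℕ) : L.Omega → ℝ :=
  (L.state θ μ t ⁻¹' L.playSet x t).indicator fun ω =>
    logRatio (inner ℝ (θ - θ') (x : Vec d)) (inner ℝ (μ - μ') (x : Vec d)) (ω.2 t)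

/-- The log-likelihood ratio at the stopping time. -/
noncomputable def stoppedLik (ω : L.Omega) : ℝ := ∑ x, ∑' t, L.playLik θ μ θ' μ' x t ω

/-- On stopping after `n` rounds, only the terms `t < n` survive, and in each of them only the
action actually played. -/
theorem stoppedLik_eq {n : ℕ} {ω : L.Omega} (h : L.state θ μ n ω ∈ L.stopSet n) :
    L.stoppedLik θ μ θ' μ' ω = L.logLik θ μ θ' μ' n ω := by
  classical
  rw [state_mem_stopSet_iff] at h
  have h1 : ∀ x, ∑' t, L.playLik θ μ θ' μ' x t ω =
      ∑ t ∈ Finset.range n, L.playLik θ μ θ' μ' x t ω := fun x => by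
    refine tsum_eq_sum fun t ht => Set.indicator_of_notMem (fun hmem => ht ?_) _
    have := (L.state_mem_runSet_iff θ μ t ω).1 hmem.1
    rw [h] at this
    exact Finset.mem_range.2 (by exact_mod_cast this)
  rw [stoppedLik, Finset.sum_congr rfl fun x _ => h1 x, Finset.sum_comm, logLik]
  refine Finset.sum_congr rfl fun t ht => ?_
  have hrun : L.state θ μ t ω ∈ L.runSet t := by
    rw [state_mem_runSet_iff, h]
    exact_mod_cast Finset.mem_range.1 ht
  rw [Finset.sum_eq_single (L.action t (L.state θ μ t ω))]
  · exact Set.indicator_of_mem (show ω ∈ L.state θ μ t ⁻¹' L.playSet _ t from ⟨hrun, rfl⟩) _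
  · intro x _ hx
    exact Set.indicator_of_notMem (fun hmem => hx hmem.2.symm) _
  · simp

theorem integrable_tsum_of_summable {Ω : Type*} [MeasurableSpace Ω] {P : Measure Ω}
    {F : ℕ → Ω → ℝ} (hF : ∀ t, Integrable (F t) P) (hFm : ∀ t, Measurable (F t))
    (hs : Summable fun t => ∫ ω, ‖F t ω‖ ∂P) : Integrable (fun ω => ∑' t, F t ω) P := by
  refine ⟨(Measurable.tsum hFm).aestronglyMeasurable, ?_⟩
  refine (lintegral_mono fun ω => enorm_tsum_le_tsum_enorm).trans_lt ?_
  rw [lintegral_tsum fun t => (hFm t).enorm.aemeasurable]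
  have : ∀ t, ∫⁻ ω, ‖F t ω‖ₑ ∂P = ENNReal.ofReal (∫ ω, ‖F t ω‖ ∂P) := fun t =>
    (ofReal_integral_norm_eq_lintegral_enorm (hF t)).symm
  simp only [this]
  exact hs.tsum_ofReal_lt_top

/-- Finiteness of the expected plays makes the series of `L¹` norms converge, which justifies
exchanging sum and expectation. -/
theorem integral_tsum_playLik {x : X} (hx : L.expectedPlays θ μ x ≠ ⊤) :
    Integrable (fun ω => ∑' t, L.playLik θ μ θ' μ' x t ω) L.law ∧
      ∫ ω, ∑' t, L.playLik θ μ θ' μ' x t ω ∂L.law = (L.expectedPlays θ μ x).toReal *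
        (((inner ℝ (θ - θ') (x : Vec d)) ^ 2 + (inner ℝ (μ - μ') (x : Vec d)) ^ 2) / 2) := by
  set a : ℝ := inner ℝ (θ - θ') (x : Vec d) with ha
  set b : ℝ := inner ℝ (μ - μ') (x : Vec d) with hb
  have hB : ∀ t, MeasurableSet (L.playSet x t) := L.measurableSet_playSet x
  have h1 : ∀ t, Integrable (L.playLik θ μ θ' μ' x t) L.law ∧
      ∫ ω, L.playLik θ μ θ' μ' x t ω ∂L.law =
        L.law.real (L.state θ μ t ⁻¹' L.playSet x t) * ∫ w, logRatio a b w ∂noise := fun t =>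
    L.integral_indicator_noise θ μ t (hB t) (measurable_logRatio a b) (integrable_logRatio a b)
  have h2 : ∀ t, ∫ ω, ‖L.playLik θ μ θ' μ' x t ω‖ ∂L.law =
        L.law.real (L.state θ μ t ⁻¹' L.playSet x t) * ∫ w, ‖logRatio a b w‖ ∂noise := fun t => by
    rw [← (L.integral_indicator_noise θ μ t (hB t) (measurable_logRatio a b).norm
      (integrable_logRatio a b).norm).2]
    simp only [playLik, norm_indicator_eq_indicator_norm, ← ha, ← hb]
  have hmeas : ∀ t, Measurable (L.playLik θ μ θ' μ' x t) := fun t =>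
    ((measurable_logRatio a b).comp (by fun_prop)).indicator
      (L.measurable_state θ μ t (hB t))
  have hsum : Summable fun t => L.law.real (L.state θ μ t ⁻¹' L.playSet x t) :=
    ENNReal.summable_toReal hx
  have hs : Summable fun t => ∫ ω, ‖L.playLik θ μ θ' μ' x t ω‖ ∂L.law := by
    simp only [h2]
    exact hsum.mul_right _
  refine ⟨integrable_tsum_of_summable (fun t => (h1 t).1) hmeas hs, ?_⟩
  rw [← integral_tsum_of_summable_integral_norm (fun t => (h1 t).1) hs]
  simp only [(h1 _).2]
  rw [tsum_mul_right, integral_logRatio, expectedPlays, ENNReal.tsum_toReal_eq fun t =>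
    measure_ne_top _ _]
  rfl

/-- The change of measure extends to the stopping time by decomposing the event according to the
round of stopping. -/
theorem measure_iUnion_change {B : (n : ℕ) → Set (L.Seed × Hist d n)}
    (hBm : ∀ n, MeasurableSet (B n)) (hB : ∀ n, B n ⊆ L.stopSet n) :
    L.law (⋃ n, L.state θ' μ' n ⁻¹' B n) = ∫⁻ ω in ⋃ n, L.state θ μ n ⁻¹' B n,
      ENNReal.ofReal (Real.exp (-L.stoppedLik θ μ θ' μ' ω)) ∂L.law := by
  rw [measure_iUnion (L.disjoint_preimage_state θ' μ' hB)
    fun n => L.measurable_state θ' μ' n (hBm n), lintegral_iUnion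
    (fun n => L.measurable_state θ μ n (hBm n)) (L.disjoint_preimage_state θ μ hB)]
  refine tsum_congr fun n => ?_
  have hm : ∀ θ μ : Vec d, MeasurableSet (L.state θ μ n ⁻¹' B n) := fun θ μ =>
    L.measurable_state θ μ n (hBm n)
  have e := L.lintegral_state_change θ μ θ' μ' n (f := (B n).indicator 1)
    (measurable_one.indicator (hBm n))
  have e1 : ∫⁻ ω, (B n).indicator 1 (L.state θ' μ' n ω) ∂L.law =
      L.law (L.state θ' μ' n ⁻¹' B n) := by
    rw [← lintegral_indicator_one (hm θ' μ')]
    rfl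
  rw [← e1, e, ← lintegral_indicator (hm θ μ)]
  refine lintegral_congr fun ω => ?_
  by_cases h : L.state θ μ n ω ∈ B n
  · rw [Set.indicator_of_mem h, Set.indicator_of_mem (by exact h),
      L.stoppedLik_eq θ μ θ' μ' (hB n h)]
    simp
  · rw [Set.indicator_of_notMem h, Set.indicator_of_notMem (by exact h), zero_mul]

/-! ### The information inequality and the lower bound -/

theorem log_le_information {γ δ : ℝ} (hδ : 0 < δ) (hδ' : δ < 1 / 2.4) (hL : L.IsPAC γ δ)
    {zstar : Vec d} (hz : IsBestArm Z γ θ μ zstar) (hT : L.expectedStoppingTime θ μ ≠ ⊤)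
    (halt : zstar ∉ correctArms Z γ θ' μ') :
    Real.log (1 / (2.4 * δ)) ≤ ∑ x, (L.expectedPlays θ μ x).toReal *
      (((inner ℝ (θ - θ') (x : Vec d)) ^ 2 + (inner ℝ (μ - μ') (x : Vec d)) ^ 2) / 2) := by
  have hfin := L.expectedPlays_ne_top θ μ hT
  have hint := fun x => L.integral_tsum_playLik θ μ θ' μ' (hfin x)
  have hval : ∫ ω, L.stoppedLik θ μ θ' μ' ω ∂L.law = ∑ x, (L.expectedPlays θ μ x).toReal *
      (((inner ℝ (θ - θ') (x : Vec d)) ^ 2 + (inner ℝ (μ - μ') (x : Vec d)) ^ 2) / 2) := by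
    unfold stoppedLik
    rw [integral_finsetSum _ fun x _ => (hint x).1]
    exact Finset.sum_congr rfl fun x _ => (hint x).2
  have hI : Integrable (L.stoppedLik θ μ θ' μ') L.law := by
    unfold stoppedLik
    exact integrable_finsetSum _ fun x _ => (hint x).1
  rw [← hval]
  refine (log_one_div_le_binary_kl hδ hδ').trans ?_
  set B : (n : ℕ) → Set (L.Seed × Hist d n) := fun n => L.returnSet {zstar} n with hBdef
  -- All other ways of stopping, including returning no arm. On the true instance `B` and `D`
  -- exhaust almost every outcome because the expected stopping time is finite.
  set D : (n : ℕ) → Set (L.Seed × Hist d n) := fun n => L.stopSet n \ B n with hDdef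
  have hB : ∀ n, B n ⊆ L.stopSet n := fun n => Set.inter_subset_left
  have hD : ∀ n, D n ⊆ L.stopSet n := fun n => Set.sdiff_subset
  have hBm : ∀ n, MeasurableSet (B n) := fun n => L.measurableSet_returnSet _ n
  have hDm : ∀ n, MeasurableSet (D n) := fun n => (L.measurableSet_stopSet n).diff (hBm n)
  have hUm : ∀ {E : (n : ℕ) → Set (L.Seed × Hist d n)} (θ μ : Vec d),
      (∀ n, MeasurableSet (E n)) → MeasurableSet (⋃ n, L.state θ μ n ⁻¹' E n) :=
    fun θ μ hE => MeasurableSet.iUnion fun n => L.measurable_state θ μ n (hE n)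
  have hdisj : ∀ θ μ : Vec d, Disjoint (⋃ n, L.state θ μ n ⁻¹' B n)
      (⋃ n, L.state θ μ n ⁻¹' D n) := by
    intro θ μ
    refine Set.disjoint_left.2 fun ω h1 h2 => ?_
    obtain ⟨m, hm⟩ := Set.mem_iUnion.1 h1
    obtain ⟨n, hn⟩ := Set.mem_iUnion.1 h2
    have e1 := (L.state_mem_stopSet_iff θ μ m ω).1 (hB m hm)
    have e2 := (L.state_mem_stopSet_iff θ μ n ω).1 (hD n hn)
    obtain rfl : m = n := by exact_mod_cast e1.symm.trans e2
    exact hn.2 hm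
  have hcorrect : correctArms Z γ θ μ = {zstar} := by
    ext z
    simp only [correctArms, Set.mem_ofPred_eq, Set.mem_singleton_iff]
    constructor
    · rintro ⟨h1, h2, h3⟩
      by_contra hne
      exact absurd (h3 zstar hz.1 hz.2.1.le) (not_le.2 (hz.2.2 z h1 hne h2))
    · rintro rfl
      refine ⟨hz.1, hz.2.1.le, fun z' h1 h2 => ?_⟩
      by_cases hne : z' = z
      · rw [hne]
      · exact (hz.2.2 z' h1 hne h2).le
  refine binary_kl_le_integral hI (hUm θ μ hBm) (hUm θ μ hDm) (hdisj θ μ) ?_ hδ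
    (hδ'.trans (by norm_num)) ?_ ?_ ?_
  · filter_upwards [L.ae_stoppingTime_ne_top θ μ hT] with ω h
    obtain ⟨n, hn⟩ := ENat.ne_top_iff_exists.1 h
    have hs := (L.state_mem_stopSet_iff θ μ n ω).2 hn.symm
    by_cases hmem : L.state θ μ n ω ∈ B n
    · exact Or.inl (Set.mem_iUnion.2 ⟨n, hmem⟩)
    · exact Or.inr (Set.mem_iUnion.2 ⟨n, hs, hmem⟩)
  · have := hL.2 θ μ ⟨zstar, hz⟩
    rwa [hcorrect, returnsIn_eq_iUnion] at this
  · rw [← L.measure_iUnion_change θ μ θ' μ' hBm hB, ← returnsIn_eq_iUnion]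
    refine (measure_mono ?_).trans (hL.1 θ' μ')
    rintro ω ⟨n, z, h1, h2, h3⟩
    refine ⟨n, z, h1, h2, ?_⟩
    rw [Set.mem_singleton_iff.1 h3]
    exact halt
  · rw [← L.measure_iUnion_change θ μ θ' μ' hBm hB, ← L.measure_iUnion_change θ μ θ' μ' hDm hD,
      ← measure_union (hdisj θ' μ') (hUm θ' μ' hDm)]
    exact prob_le_one

theorem exists_allocation (hX : Nonempty X) (hT : L.expectedStoppingTime θ μ ≠ ⊤) :
    ∃ lam ∈ stdSimplex ℝ X, ∀ x, (L.expectedPlays θ μ x).toReal =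
      (L.expectedStoppingTime θ μ).toReal * lam x := by
  classical
  have hfin := L.expectedPlays_ne_top θ μ hT
  have hsum : ∑ x, (L.expectedPlays θ μ x).toReal = (L.expectedStoppingTime θ μ).toReal := by
    rw [← sum_expectedPlays, ENNReal.toReal_sum fun x _ => hfin x]
  rcases eq_or_ne (L.expectedStoppingTime θ μ).toReal 0 with h0 | h0
  -- With zero expected time every play count vanishes, so any allocation works.
  · refine ⟨Pi.single hX.some 1, single_mem_stdSimplex ℝ _, fun x => ?_⟩
    rw [h0, zero_mul]
    rw [h0] at hsum
    exact (Finset.sum_eq_zero_iff_of_nonneg fun _ _ => ENNReal.toReal_nonneg).1 hsum x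
      (Finset.mem_univ x)
  · refine ⟨fun x => (L.expectedPlays θ μ x).toReal / (L.expectedStoppingTime θ μ).toReal,
      ⟨fun x => by positivity, ?_⟩, fun x => by field_simp⟩
    rw [← Finset.sum_div, hsum, div_self h0]

theorem nonempty_actions (L : Learner.{u} X Z) : Nonempty X := by
  have : Nonempty L.Seed := nonempty_of_isProbabilityMeasure L.seedLaw
  exact ⟨L.action 0 (Classical.arbitrary _, Fin.elim0)⟩

end Learner

end SafeBandit

theorem mainTheorem2 {d : ℕ} (X Z : Finset (SafeBandit.Vec d)) (γ δ : ℝ)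
    (hδ_pos : 0 < δ) (hδ_lt : δ < 1 / 2.4)
    (L : SafeBandit.Learner X Z) (hL : L.IsPAC γ δ)
    (θstar μstar zstar : SafeBandit.Vec d)
    (hz : SafeBandit.IsBestArm Z γ θstar μstar zstar) :
    SafeBandit.complexity X Z γ θstar μstar zstar ≤
      L.expectedStoppingTime θstar μstar / ENNReal.ofReal (Real.log (1 / (2.4 * δ))) := by
  open SafeBandit in
  set l := Real.log (1 / (2.4 * δ)) with hl
  have hlpos : 0 < l := by
    refine Real.log_pos ?_
    rw [lt_one_div (by norm_num) (by positivity)]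
    rw [lt_div_iff₀ (by norm_num)] at hδ_lt
    linarith
  rcases eq_or_ne (L.expectedStoppingTime θstar μstar) ⊤ with htop | hT
  · rw [htop, ENNReal.top_div_of_ne_top ENNReal.ofReal_ne_top]
    exact le_top
  obtain ⟨lam, hlam, hplays⟩ := L.exists_allocation θstar μstar L.nonempty_actions hT
  set T := (L.expectedStoppingTime θstar μstar).toReal with hTdef
  have hT0 : 0 ≤ T := ENNReal.toReal_nonneg
  set A := designMatrix X lam with hA
  have hApsd : A.PosSemidef := posSemidef_designMatrix X hlam.1
  have hinfo : ∀ η η' : Vec d, zstar ∉ correctArms Z γ (θstar + η) (μstar + η') →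
      1 ≤ (T / l * quadForm A η + T / l * quadForm A η') / 2 := by
    intro η η' h
    have h1 := L.log_le_information θstar μstar (θstar + η) (μstar + η') hδ_pos hδ_lt hL hz hT h
    have h2 : ∑ x, (L.expectedPlays θstar μstar x).toReal *
        (((inner ℝ (θstar - (θstar + η)) (x : Vec d)) ^ 2 +
          (inner ℝ (μstar - (μstar + η')) (x : Vec d)) ^ 2) / 2) =
        T * (quadForm A η + quadForm A η') / 2 := by
      rw [quadForm_designMatrix, quadForm_designMatrix, ← Finset.sum_add_distrib, Finset.mul_sum,
        Finset.sum_div]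
      refine Finset.sum_congr rfl fun x _ => ?_
      rw [hplays, sub_add_cancel_left, sub_add_cancel_left, inner_neg_left, inner_neg_left]
      ring
    rw [h2] at h1
    have : (T / l * quadForm A η + T / l * quadForm A η') / 2 =
        (T * (quadForm A η + quadForm A η') / 2) / l := by ring
    rw [this, le_div_iff₀ hlpos, one_mul]
    exact h1
  have hR : 0 ≤ T / l := by positivity
  have hrhs : L.expectedStoppingTime θstar μstar / ENNReal.ofReal l = ENNReal.ofReal (T / l) := by
    rw [ENNReal.ofReal_div_of_pos hlpos, hTdef, ENNReal.ofReal_toReal hT]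
  rw [hrhs]
  refine (iInf₂_le lam hlam).trans (max_le (iSup₂_le fun z hzZ => iSup_le fun hne => ?_) ?_)
  · by_contra! hlt
    obtain ⟨hlt1, hlt2⟩ := lt_min_iff.1 hlt
    obtain ⟨η', h1, h2⟩ := exists_weak_perturbation hApsd hR hlt1
    obtain ⟨η, h3, h4⟩ := exists_perturbation hApsd hR (sub_ne_zero.2 hne) hlt2
    have hq : quadForm A (-η') = quadForm A η' := by
      simp [quadForm, Matrix.mulVec_neg]
    -- Under this perturbation `z` is safe and has strictly larger value than `zstar`, which is
    -- therefore incorrect whether or not it stays safe itself.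
    have := hinfo η (-η') fun hc => by
      have hsafe : IsSafe γ (μstar + -η') z := by
        rw [IsSafe, inner_add_right, inner_neg_right]
        rw [safetyGap, real_inner_comm] at h1
        linarith
      have h5 := hc.2.2 z hzZ hsafe
      rw [inner_add_right, inner_add_right] at h5
      rw [gap, inner_sub_right, inner_sub_left, real_inner_comm, real_inner_comm z] at h3
      linarith
    rw [hq] at this
    linarith
  · by_contra! hlt
    have hpos : 0 < γ - inner ℝ zstar μstar := sub_pos.2 hz.2.1
    rw [show (inner ℝ zstar μstar - γ) ^ 2 = (γ - inner ℝ zstar μstar) ^ 2 by ring] at hlt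
    obtain ⟨η', h1, h2⟩ := exists_perturbation_of_lt_ratio hApsd hR hpos hlt
    -- Changing the constraint alone makes `zstar` unsafe, possibly leaving no safe arm; the first
    -- PAC condition covers such instances too.
    have := hinfo 0 η' fun hc => by
      have h3 : (inner ℝ zstar (μstar + η') : ℝ) ≤ γ := hc.2.1
      rw [inner_add_right] at h3
      linarith
    have h0 : quadForm A 0 = 0 := by simp [quadForm]
    rw [h0, mul_zero] at this
    linarith
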